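/- Let $n\in\mathbb N$, $\alpha>0$, $a\in\mathbb R$, $b\ge 0$. Let $u\colon\mathbb R^n\times[0,\infty)\to[0,\infty]$ be a function (the value $+\infty$ meaning that $x$ is not in the domain of $u(\cdot,t)$), and let $M_t=\operatorname{graph}u(\cdot,t)=\{(x,u(x,t)) : u(x,t)<\infty\}\subset\mathbb R^{n}\times\mathbb R=\mathbb R^{n+1}$. Suppose that - $\{x : u(x,t)\le a\}$ is compact for every $t\ge 0$; - $\min\{u,a+1\}$ is continuous on $\mathbb R^n\times[0,\infty)$; - on $\{(x,t) : t\ge 0,\ u(x,t)<a+1\}$ the function $u$ is smooth, the mean curvature of its graph is positive, $H=\operatorname{div}\bigl(\nabla u/\sqrt{1+|\nabla u|^2}\bigr)>0$, and $u$ solves the graphical $H^\alpha$-flow $$\frac{\partial_t u}{\sqrt{1+|\nabla u|^2}}=H^\alpha .$$ For $X=(X^1,\dots,X^{n+1})\in M_t$ put $\psi(X,t)=(a-bt-X^{n+1})_+$. Let $I=\inf_{t=0}\psi^{-1}H^\alpha$ be the infimum of $\psi^{-1}H^\alpha$ over all points of $M_0$ with $\psi>0$ (with $I=+\infty$ if there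 are none). Then for every $t\ge0$ and at every point of $M_t$ with $\psi>0$, $$\psi^{-1}H^\alpha\ \ge\ \begin{cases} I, & \alpha\le 1,\\[2pt] \min\Bigl\{I,\ \dfrac{b}{a(\alpha-1)}\Bigr\}, & \alpha>1.\end{cases}$$ Moreover $I>0$. Consequently, if $\alpha\le1$ or $b>0$, the speed is locally bounded below: for every $\delta>0$ there is $c>0$ such that $H^\alpha\ge c$ at every point of every $M_t$, $t\ge0$, with $\psi\ge\delta$. -/

import Mathlib

open scoped ContDiff

noncomputable section

/-- `√(1 + |∇f|²)`, for a real function `f` on `ℝⁿ`. -/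
def areaElement {n : ℕ} (f : EuclideanSpace ℝ (Fin n) → ℝ) (x : EuclideanSpace ℝ (Fin n)) : ℝ :=
  Real.sqrt (1 + ‖gradient f x‖ ^ 2)

/-- The mean curvature `H = div (∇f / √(1 + |∇f|²))` of the graph of `f` at the point over `x`
(with respect to the upward unit normal). -/
def graphMeanCurvature {n : ℕ} (f : EuclideanSpace ℝ (Fin n) → ℝ)
    (x : EuclideanSpace ℝ (Fin n)) : ℝ :=
  ∑ i : Fin n,
    (fderiv ℝ (fun y => (areaElement f y)⁻¹ • gradient f y) x (EuclideanSpace.single i 1)) i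

/-- A time-dependent graph is given by a function `u` of `x ∈ ℝⁿ` and `t ≥ 0` with extended real
values; the value `⊤` means that there is no point of the hypersurface over `x` at time `t`.
`slice u t` is the function `u(·, t)` where it is finite (its other values are never used). -/
def slice {n : ℕ} (u : EuclideanSpace ℝ (Fin n) → ℝ → EReal) (t : ℝ) :
    EuclideanSpace ℝ (Fin n) → ℝ :=
  fun x => (u x t).toReal

/-- The hypersurface `M_t = graph u(·, t)` in `ℝⁿ × ℝ = ℝⁿ⁺¹`. -/
def graphAt {n : ℕ} (u : EuclideanSpace ℝ (Fin n) → ℝ → EReal) (t : ℝ) :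
    Set (EuclideanSpace ℝ (Fin n) × ℝ) :=
  {X | u X.1 t = (X.2 : EReal)}

/-- The region `{(x, t) : t ≥ 0, u(x, t) < h}` of space-time. -/
def below {n : ℕ} (u : EuclideanSpace ℝ (Fin n) → ℝ → EReal) (h : ℝ) :
    Set (EuclideanSpace ℝ (Fin n) × ℝ) :=
  {p | 0 ≤ p.2 ∧ u p.1 p.2 < (h : EReal)}

/-- Below height `h`, the hypersurfaces `graph u(·, t)`, `t ≥ 0`, are smooth and strictly mean
convex and move by the `H^α`-flow. What happens above height `h` is irrelevant, hence only the
truncation `min u h` is required to be continuous as a function of `(x, t)`. -/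
structure IsHAlphaFlowBelow {n : ℕ} (α h : ℝ) (u : EuclideanSpace ℝ (Fin n) → ℝ → EReal) :
    Prop where
  continuousOn : ContinuousOn
    (fun p : EuclideanSpace ℝ (Fin n) × ℝ => min (u p.1 p.2) (h : EReal)) {p | 0 ≤ p.2}
  smooth : ContDiffOn ℝ ∞ (fun p : EuclideanSpace ℝ (Fin n) × ℝ => slice u p.2 p.1) (below u h)
  meanCurvature_pos : ∀ p ∈ below u h, 0 < graphMeanCurvature (slice u p.2) p.1
  /-- The equation `∂ₜu = √(1 + |∇u|²) H^α` (with one-sided time derivative at `t = 0`). -/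
  flow : ∀ p ∈ below u h,
    HasDerivWithinAt (fun s => slice u s p.1)
      (areaElement (slice u p.2) p.1 * graphMeanCurvature (slice u p.2) p.1 ^ α)
      (Set.Ici 0) p.2

/-- The localization function `ψ = (a - b t - X^{n+1})₊` at the point `X ∈ ℝⁿ⁺¹` and time `t`. -/
def cutoff {n : ℕ} (a b t : ℝ) (X : EuclideanSpace ℝ (Fin n) × ℝ) : ℝ :=
  max (a - b * t - X.2) 0

/-- The normal speed `H^α` of the hypersurface `graph u(·, t)` at its point `X`. -/
def speed {n : ℕ} (α : ℝ) (u : EuclideanSpace ℝ (Fin n) → ℝ → EReal) (t : ℝ)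
    (X : EuclideanSpace ℝ (Fin n) × ℝ) : ℝ :=
  graphMeanCurvature (slice u t) X.1 ^ α

/-- The part of `graph u(·, t)` on which `ψ > 0`. -/
def localizedGraph {n : ℕ} (a b : ℝ) (u : EuclideanSpace ℝ (Fin n) → ℝ → EReal) (t : ℝ) :
    Set (EuclideanSpace ℝ (Fin n) × ℝ) :=
  {X ∈ graphAt u t | 0 < cutoff a b t X}

/-- `inf_{t = 0} ψ⁻¹ H^α`, the infimum over the points of the initial hypersurface with `ψ > 0`
(it is `⊤` if there are none). -/
def initialInf {n : ℕ} (α a b : ℝ) (u : EuclideanSpace ℝ (Fin n) → ℝ → EReal) : EReal :=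
  ⨅ X ∈ localizedGraph a b u 0, (((cutoff a b 0 X)⁻¹ * speed α u 0 X : ℝ) : EReal)

end

/-! The proof is a minimum principle for the ratio H^α / (a - bt - u) on space-time. Write S = H^α,
W = √(1 + |∇u|²) and N = ∇u / W. Suppose a minimum m of the ratio over the times up to a given one
is attained at a point p with t > 0. Then f = S - m (a - bt - u) vanishes at p and is nonnegative
near p at times no later than that of p, so ∇f = 0, D²f ≥ 0 and ∂ₜf ≤ 0 at p. Tracing D²f with the
inverse metric 1 - N Nᵀ and inserting the evolution equation of H
(`dirDeriv_divNormalizedGrad_of_flow`) gives m b + (1 - α) m S / W + α H^(α-1) S |A|² ≤ 0, where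
|A|² = tr(∇N ∇N) is positive because H > 0 (`sum_mul_transpose_pos`). Since W ≥ 1, this is absurd if
α ≤ 1 or (α - 1) S ≤ b; this is `false_of_touching`. Hence the minimum sits at t = 0.

For α > 1, a ratio of at most b / (a (α - 1)) forces (α - 1) S ≤ b at the minimum, because a - bt -
u ≤ a; a larger ratio satisfies the claimed bound outright.

A minimum exists because u increases in time, so the part of space-time with u ≤ a stays over the
compact set where u(·, 0) ≤ a. On that set H^α has a positive minimum at t = 0, and ψ ≤ a, whence I
> 0. -/

/-! ### Calculus of directional derivatives within a set, and conditions at a minimum. -/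

section DirectionalDerivative

variable {V : Type*} [NormedAddCommGroup V] [NormedSpace ℝ V] {s : Set V}

/-- The derivative of `g` within `s` in the direction `v`, as a function of the point. -/
noncomputable def dirDeriv (s : Set V) (v : V) (g : V → ℝ) (p : V) : ℝ := fderivWithin ℝ g s p v

theorem contDiffOn_dirDeriv (hs : UniqueDiffOn ℝ s) {g : V → ℝ} (hg : ContDiffOn ℝ ∞ g s) (v : V) :
    ContDiffOn ℝ ∞ (dirDeriv s v g) s :=
  (hg.fderivWithin hs (m := ∞) (by simp)).clm_apply contDiffOn_const

theorem smooth_hasFDerivWithinAt {g : V → ℝ} (hg : ContDiffOn ℝ ∞ g s) {p : V} (hp : p ∈ s) :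
    HasFDerivWithinAt g (fderivWithin ℝ g s p) s p :=
  ((hg.differentiableOn (by simp)) p hp).hasFDerivWithinAt

theorem dirDeriv_eq_of_hasFDerivWithinAt (hs : UniqueDiffOn ℝ s) {g : V → ℝ} {g' : V →L[ℝ] ℝ}
    {p : V} (hp : p ∈ s) (hg : HasFDerivWithinAt g g' s p) (v : V) : dirDeriv s v g p = g' v := by
  rw [dirDeriv, hg.fderivWithin (hs p hp)]

theorem dirDeriv_congr {f g : V → ℝ} (h : Set.EqOn f g s) {p : V} (hp : p ∈ s) (v : V) :
    dirDeriv s v f p = dirDeriv s v g p := by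
  rw [dirDeriv, dirDeriv, fderivWithin_congr h (h hp)]

theorem dirDeriv_const (c : ℝ) (p v : V) : dirDeriv s v (fun _ => c) p = 0 := by
  simp [dirDeriv]

theorem dirDeriv_add (hs : UniqueDiffOn ℝ s) {f g : V → ℝ} (hf : ContDiffOn ℝ ∞ f s)
    (hg : ContDiffOn ℝ ∞ g s) {p : V} (hp : p ∈ s) (v : V) :
    dirDeriv s v (fun q => f q + g q) p = dirDeriv s v f p + dirDeriv s v g p :=
  dirDeriv_eq_of_hasFDerivWithinAt hs hp
    ((smooth_hasFDerivWithinAt hf hp).add (smooth_hasFDerivWithinAt hg hp)) v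

theorem dirDeriv_sub (hs : UniqueDiffOn ℝ s) {f g : V → ℝ} (hf : ContDiffOn ℝ ∞ f s)
    (hg : ContDiffOn ℝ ∞ g s) {p : V} (hp : p ∈ s) (v : V) :
    dirDeriv s v (fun q => f q - g q) p = dirDeriv s v f p - dirDeriv s v g p :=
  dirDeriv_eq_of_hasFDerivWithinAt hs hp
    ((smooth_hasFDerivWithinAt hf hp).sub (smooth_hasFDerivWithinAt hg hp)) v

theorem dirDeriv_mul (hs : UniqueDiffOn ℝ s) {f g : V → ℝ} (hf : ContDiffOn ℝ ∞ f s)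
    (hg : ContDiffOn ℝ ∞ g s) {p : V} (hp : p ∈ s) (v : V) :
    dirDeriv s v (fun q => f q * g q) p = f p * dirDeriv s v g p + dirDeriv s v f p * g p := by
  refine (dirDeriv_eq_of_hasFDerivWithinAt hs hp
    ((smooth_hasFDerivWithinAt hf hp).mul (smooth_hasFDerivWithinAt hg hp)) v).trans ?_
  simp [dirDeriv, mul_comm]

theorem dirDeriv_sum (hs : UniqueDiffOn ℝ s) {ι : Type*} [Fintype ι] {f : ι → V → ℝ}
    (hf : ∀ i, ContDiffOn ℝ ∞ (f i) s) {p : V} (hp : p ∈ s) (v : V) :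
    dirDeriv s v (fun q => ∑ i, f i q) p = ∑ i, dirDeriv s v (f i) p := by
  rw [dirDeriv_eq_of_hasFDerivWithinAt hs hp
    (HasFDerivWithinAt.fun_sum fun i _ => smooth_hasFDerivWithinAt (hf i) hp) v]
  simp [dirDeriv]

theorem dirDeriv_rpow (hs : UniqueDiffOn ℝ s) {f : V → ℝ} (hf : ContDiffOn ℝ ∞ f s) (r : ℝ)
    {p : V} (hp : p ∈ s) (h : f p ≠ 0) (v : V) :
    dirDeriv s v (fun q => f q ^ r) p = r * f p ^ (r - 1) * dirDeriv s v f p := by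
  rw [dirDeriv_eq_of_hasFDerivWithinAt hs hp
    ((smooth_hasFDerivWithinAt hf hp).rpow_const (Or.inl h)) v]
  simp [dirDeriv]

/-- Second derivatives within a set are symmetric also at boundary points that are limits of
interior points. This covers the initial time t = 0. -/
theorem dirDeriv_comm (hs : UniqueDiffOn ℝ s) (hs' : s ⊆ closure (interior s)) {f : V → ℝ}
    (hf : ContDiffOn ℝ ∞ f s) {p : V} (hp : p ∈ s) (v w : V) :
    dirDeriv s v (dirDeriv s w f) p = dirDeriv s w (dirDeriv s v f) p := by
  have key : ∀ v w : V, dirDeriv s v (dirDeriv s w f) p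
      = fderivWithin ℝ (fderivWithin ℝ f s) s p v w := by
    intro v w
    have h1 : DifferentiableWithinAt ℝ (fderivWithin ℝ f s) s p :=
      (hf.fderivWithin hs (m := ∞) (by simp)).differentiableOn (by simp) p hp
    have h2 := h1.hasFDerivWithinAt.clm_apply (hasFDerivWithinAt_const w p s)
    refine (dirDeriv_eq_of_hasFDerivWithinAt hs hp h2 v).trans ?_
    simp
  rw [key, key]
  have htwo : minSmoothness ℝ 2 ≤ ∞ := by
    rw [minSmoothness_of_isRCLikeNormedField]
    exact WithTop.coe_le_coe.2 (le_top : (2 : ℕ∞) ≤ ⊤)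
  exact ((hf p hp).isSymmSndFDerivWithinAt htwo hs (hs' hp) hp).eq v w

theorem dirDeriv_linearCombination {ι : Type*} [Fintype ι] (c : ι → ℝ) (e : ι → V) (f : V → ℝ)
    (p : V) : dirDeriv s (∑ i, c i • e i) f p = ∑ i, c i * dirDeriv s (e i) f p := by
  simp [dirDeriv]

theorem dirDeriv_dirDeriv_linearCombination (hs : UniqueDiffOn ℝ s) {ι : Type*} [Fintype ι]
    (c : ι → ℝ) (e : ι → V) {f : V → ℝ} (hf : ContDiffOn ℝ ∞ f s) {p : V} (hp : p ∈ s) :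
    dirDeriv s (∑ i, c i • e i) (dirDeriv s (∑ i, c i • e i) f) p
      = ∑ i, ∑ j, c i * c j * dirDeriv s (e i) (dirDeriv s (e j) f) p := by
  have h1 : dirDeriv s (∑ i, c i • e i) f = fun q => ∑ j, c j * dirDeriv s (e j) f q :=
    funext fun q => dirDeriv_linearCombination c e f q
  rw [dirDeriv_linearCombination, h1]
  refine Finset.sum_congr rfl fun i _ => ?_
  rw [dirDeriv_sum hs (fun j => contDiffOn_const.mul (contDiffOn_dirDeriv hs hf _)) hp,
    Finset.mul_sum]
  refine Finset.sum_congr rfl fun j _ => ?_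
  rw [dirDeriv_mul hs contDiffOn_const (contDiffOn_dirDeriv hs hf _) hp, dirDeriv_const]
  ring

theorem hasDerivWithinAt_along_line {f : V → ℝ} (hf : ContDiffOn ℝ ∞ f s) {p w : V} {I : Set ℝ}
    (hI : ∀ r ∈ I, p + r • w ∈ s) {r : ℝ} (hr : r ∈ I) :
    HasDerivWithinAt (fun r : ℝ => f (p + r • w)) (dirDeriv s w f (p + r • w)) I r := by
  have h1 : HasDerivWithinAt (fun r : ℝ => p + r • w) w I r := by
    simpa using ((hasDerivWithinAt_id r I).smul_const w).const_add p
  have h2 := HasFDerivWithinAt.comp_hasDerivWithinAt (f := fun r : ℝ => p + r • w) r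
    (smooth_hasFDerivWithinAt hf (hI r hr)) h1 hI
  exact h2

theorem nonpos_of_hasDerivWithinAt_of_left_min {g : ℝ → ℝ} {d r : ℝ}
    (hg : HasDerivWithinAt g d (Set.Iio r) r) (hmin : ∀ᶠ x in nhdsWithin r (Set.Iio r), g r ≤ g x) :
    d ≤ 0 := by
  have h := (hasDerivWithinAt_iff_tendsto_slope' (by simp)).1 hg
  refine le_of_tendsto h ?_
  filter_upwards [hmin, self_mem_nhdsWithin] with x hx hxr
  rw [slope_def_field]
  exact div_nonpos_of_nonneg_of_nonpos (by linarith) (by simpa using le_of_lt hxr)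

theorem dirDeriv_nonpos_of_left_min {f : V → ℝ} (hf : ContDiffOn ℝ ∞ f s) {p w : V} (hp : p ∈ s)
    (hs : ∀ᶠ r : ℝ in nhdsWithin 0 (Set.Iio 0), p + r • w ∈ s)
    (hmin : ∀ᶠ r : ℝ in nhdsWithin 0 (Set.Iio 0), f p ≤ f (p + r • w)) :
    dirDeriv s w f p ≤ 0 := by
  have h : HasDerivWithinAt (fun r : ℝ => f (p + r • w)) (dirDeriv s w f (p + (0 : ℝ) • w))
      {r : ℝ | p + r • w ∈ s} 0 :=
    hasDerivWithinAt_along_line hf (fun r hr => hr) (show p + (0 : ℝ) • w ∈ s by simpa using hp)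
  rw [zero_smul, add_zero] at h
  refine nonpos_of_hasDerivWithinAt_of_left_min (h.mono_of_mem_nhdsWithin hs) ?_
  filter_upwards [hmin] with r hr
  rwa [zero_smul, add_zero]

/-- Everything reduces to the restriction of f to the line. If its second derivative were negative,
the critical point would also be a local maximum, so the restriction would be locally constant and
its second derivative zero. -/
theorem dirDeriv_of_line_min (hs : UniqueDiffOn ℝ s) {f : V → ℝ} (hf : ContDiffOn ℝ ∞ f s)
    {p w : V} (hps : ∀ᶠ r : ℝ in nhds 0, p + r • w ∈ s)
    (hmin : ∀ᶠ r : ℝ in nhds 0, f p ≤ f (p + r • w)) :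
    dirDeriv s w f p = 0 ∧ 0 ≤ dirDeriv s w (dirDeriv s w f) p := by
  have hder : ∀ g : V → ℝ, ContDiffOn ℝ ∞ g s →
      ∀ᶠ r : ℝ in nhds 0, HasDerivAt (fun r : ℝ => g (p + r • w)) (dirDeriv s w g (p + r • w)) r := by
    intro g hg
    filter_upwards [eventually_eventually_nhds.2 hps] with r hr
    exact (hasDerivWithinAt_along_line hg (I := {r | p + r • w ∈ s}) (fun _ h => h)
      hr.self_of_nhds).hasDerivAt hr
  set φ : ℝ → ℝ := fun r => f (p + r • w) with hφ
  have hloc : IsLocalMin φ 0 := by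
    filter_upwards [hmin] with r hr
    simpa [hφ] using hr
  have hd1 : deriv φ =ᶠ[nhds 0] fun r => dirDeriv s w f (p + r • w) := by
    filter_upwards [hder f hf] with r hr using hr.deriv
  have hd2 : deriv (deriv φ) 0 = dirDeriv s w (dirDeriv s w f) p := by
    rw [hd1.deriv_eq, (hder _ (contDiffOn_dirDeriv hs hf w)).self_of_nhds.deriv]
    simp
  have hd0 : deriv φ 0 = dirDeriv s w f p := by simpa using hd1.self_of_nhds
  refine ⟨hd0 ▸ hloc.deriv_eq_zero, ?_⟩
  rw [← hd2]
  by_contra! hneg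
  have hmax := isLocalMax_of_deriv_deriv_neg hneg hloc.deriv_eq_zero
    (hder f hf).self_of_nhds.continuousAt
  have hconst : φ =ᶠ[nhds 0] fun _ => φ 0 := by
    filter_upwards [hloc, hmax] with r h1 h2 using le_antisymm h2 h1
  have : deriv φ =ᶠ[nhds 0] fun _ => 0 := by
    filter_upwards [hconst.eventuallyEq_nhds] with r hr
    rw [hr.deriv_eq]; simp
  rw [this.deriv_eq] at hneg
  simp at hneg

end DirectionalDerivative

/-! ### Evolution of the unit normal and the mean curvature of a graph. -/

section GraphEvolution

variable {V : Type*} [NormedAddCommGroup V] [NormedSpace ℝ V] {s : Set V}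
  {ι : Type*} [Fintype ι]

/-- `√(1 + ∑ᵢ (∂ᵢU)²)`, where the `∂ᵢ` are the derivatives in the directions `e i`. -/
noncomputable def areaDensity (s : Set V) (e : ι → V) (U : V → ℝ) (p : V) : ℝ :=
  Real.sqrt (1 + ∑ k, dirDeriv s (e k) U p ^ 2)

/-- The components `∂ᵢU / √(1 + |∇U|²)` of the normalized gradient. -/
noncomputable def normalizedGrad (s : Set V) (e : ι → V) (U : V → ℝ) (i : ι) (p : V) : ℝ :=
  (areaDensity s e U p)⁻¹ * dirDeriv s (e i) U p

/-- The divergence `∑ᵢ ∂ᵢ(∂ᵢU / √(1 + |∇U|²))` of the normalized gradient. -/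
noncomputable def divNormalizedGrad (s : Set V) (e : ι → V) (U : V → ℝ) (p : V) : ℝ :=
  ∑ i, dirDeriv s (e i) (normalizedGrad s e U i) p

variable {e : ι → V} {U : V → ℝ}

theorem one_add_sum_sq_pos (p : V) : 0 < 1 + ∑ k, dirDeriv s (e k) U p ^ 2 := by positivity

theorem areaDensity_sq (p : V) :
    areaDensity s e U p * areaDensity s e U p = 1 + ∑ k, dirDeriv s (e k) U p ^ 2 :=
  Real.mul_self_sqrt (one_add_sum_sq_pos p).le

theorem one_le_areaDensity (p : V) : 1 ≤ areaDensity s e U p :=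
  Real.one_le_sqrt.2 (le_add_of_nonneg_right (by positivity))

theorem areaDensity_pos (p : V) : 0 < areaDensity s e U p :=
  zero_lt_one.trans_le (one_le_areaDensity p)

theorem dirDeriv_eq_areaDensity_mul (i : ι) (p : V) :
    dirDeriv s (e i) U p = areaDensity s e U p * normalizedGrad s e U i p := by
  rw [normalizedGrad, mul_inv_cancel_left₀ (areaDensity_pos p).ne']

theorem areaDensity_mul_self_mul_sum_sq (p : V) :
    areaDensity s e U p * areaDensity s e U p * ∑ k, normalizedGrad s e U k p ^ 2
      = areaDensity s e U p * areaDensity s e U p - 1 := by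
  conv_rhs => rw [areaDensity_sq]
  rw [add_sub_cancel_left, Finset.mul_sum]
  refine Finset.sum_congr rfl fun k _ => ?_
  rw [dirDeriv_eq_areaDensity_mul k p]; ring

theorem contDiffOn_areaDensity (hs : UniqueDiffOn ℝ s) (hU : ContDiffOn ℝ ∞ U s) :
    ContDiffOn ℝ ∞ (areaDensity s e U) s :=
  (contDiffOn_const.add (ContDiffOn.sum fun k _ => (contDiffOn_dirDeriv hs hU (e k)).pow 2)).sqrt
    fun p _ => (one_add_sum_sq_pos p).ne'

theorem contDiffOn_normalizedGrad (hs : UniqueDiffOn ℝ s) (hU : ContDiffOn ℝ ∞ U s) (i : ι) :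
    ContDiffOn ℝ ∞ (normalizedGrad s e U i) s :=
  ((contDiffOn_areaDensity hs hU).inv fun p _ => (areaDensity_pos p).ne').mul
    (contDiffOn_dirDeriv hs hU (e i))

theorem contDiffOn_divNormalizedGrad (hs : UniqueDiffOn ℝ s) (hU : ContDiffOn ℝ ∞ U s) :
    ContDiffOn ℝ ∞ (divNormalizedGrad s e U) s :=
  ContDiffOn.sum fun i _ => contDiffOn_dirDeriv hs (contDiffOn_normalizedGrad hs hU i) (e i)

/-- Obtained by differentiating W² = 1 + |∇U|², which avoids the derivative of the square root. -/
theorem dirDeriv_areaDensity (hs : UniqueDiffOn ℝ s) (hU : ContDiffOn ℝ ∞ U s) {p : V}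
    (hp : p ∈ s) (v : V) :
    dirDeriv s v (areaDensity s e U) p
      = ∑ k, normalizedGrad s e U k p * dirDeriv s v (dirDeriv s (e k) U) p := by
  have hW := contDiffOn_areaDensity (e := e) hs hU
  have hk := fun k => contDiffOn_dirDeriv hs hU (e k)
  have h1 := dirDeriv_congr (s := s) (f := fun q => areaDensity s e U q * areaDensity s e U q)
    (g := fun q => 1 + ∑ k, dirDeriv s (e k) U q * dirDeriv s (e k) U q)
    (fun q _ => by simp only [areaDensity_sq, sq]) hp v
  rw [dirDeriv_mul hs hW hW hp, dirDeriv_add hs contDiffOn_const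
    (ContDiffOn.sum fun k _ => (hk k).mul (hk k)) hp, dirDeriv_const,
    dirDeriv_sum hs (fun k => (hk k).mul (hk k)) hp] at h1
  have h2 : ∀ k, dirDeriv s v (fun q => dirDeriv s (e k) U q * dirDeriv s (e k) U q) p
      = 2 * areaDensity s e U p
        * (normalizedGrad s e U k p * dirDeriv s v (dirDeriv s (e k) U) p) := by
    intro k
    rw [dirDeriv_mul hs (hk k) (hk k) hp, dirDeriv_eq_areaDensity_mul k p]; ring
  simp only [h2, ← Finset.mul_sum] at h1
  refine mul_left_cancel₀ (mul_pos two_pos (areaDensity_pos (s := s) (e := e) (U := U) p)).ne' ?_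
  linarith

/-- Obtained by differentiating ∂ᵢU = W Nᵢ. It says W ∇N = (1 - N Nᵀ) D²U. -/
theorem areaDensity_mul_dirDeriv_normalizedGrad (hs : UniqueDiffOn ℝ s) (hU : ContDiffOn ℝ ∞ U s)
    {p : V} (hp : p ∈ s) (v : V) (i : ι) :
    areaDensity s e U p * dirDeriv s v (normalizedGrad s e U i) p
      = dirDeriv s v (dirDeriv s (e i) U) p - normalizedGrad s e U i p
        * ∑ k, normalizedGrad s e U k p * dirDeriv s v (dirDeriv s (e k) U) p := by
  have h1 := dirDeriv_congr (s := s) (f := dirDeriv s (e i) U)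
    (g := fun q => areaDensity s e U q * normalizedGrad s e U i q)
    (fun q _ => dirDeriv_eq_areaDensity_mul i q) hp v
  rw [dirDeriv_mul hs (contDiffOn_areaDensity hs hU) (contDiffOn_normalizedGrad hs hU i) hp,
    dirDeriv_areaDensity hs hU hp] at h1
  linarith

/-- The evolution of the normalized gradient when `∂_τ U = √(1 + |∇U|²) S`. -/
theorem dirDeriv_normalizedGrad_of_flow (hs : UniqueDiffOn ℝ s) (hs' : s ⊆ closure (interior s))
    (hU : ContDiffOn ℝ ∞ U s) {S : V → ℝ} (hS : ContDiffOn ℝ ∞ S s) {τ : V}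
    (hflow : ∀ q ∈ s, dirDeriv s τ U q = areaDensity s e U q * S q) {p : V} (hp : p ∈ s) (i : ι) :
    dirDeriv s τ (normalizedGrad s e U i) p
      = dirDeriv s (e i) S p
        - normalizedGrad s e U i p * ∑ j, normalizedGrad s e U j p * dirDeriv s (e j) S p
        + S p * ∑ k, dirDeriv s (e k) (normalizedGrad s e U i) p * normalizedGrad s e U k p := by
  have hW := areaDensity_pos (s := s) (e := e) (U := U) p
  have h1 : ∀ j, dirDeriv s τ (dirDeriv s (e j) U) p
      = areaDensity s e U p * dirDeriv s (e j) S p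
        + S p * ∑ k, normalizedGrad s e U k p * dirDeriv s (e k) (dirDeriv s (e j) U) p := by
    intro j
    rw [dirDeriv_comm hs hs' hU hp, dirDeriv_congr hflow hp,
      dirDeriv_mul hs (contDiffOn_areaDensity hs hU) hS hp, dirDeriv_areaDensity hs hU hp,
      mul_comm (S p)]
    simp only [dirDeriv_comm hs hs' hU hp (e j)]
  refine mul_left_cancel₀ hW.ne' ?_
  rw [areaDensity_mul_dirDeriv_normalizedGrad hs hU hp]
  have h2 : areaDensity s e U p
        * ∑ k, dirDeriv s (e k) (normalizedGrad s e U i) p * normalizedGrad s e U k p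
      = ∑ k, normalizedGrad s e U k p * dirDeriv s (e k) (dirDeriv s (e i) U) p
        - normalizedGrad s e U i p * ∑ j, normalizedGrad s e U j p *
          ∑ k, normalizedGrad s e U k p * dirDeriv s (e k) (dirDeriv s (e j) U) p := by
    simp only [Finset.mul_sum]
    rw [Finset.sum_comm, ← Finset.sum_sub_distrib]
    refine Finset.sum_congr rfl fun k _ => ?_
    rw [← mul_assoc, areaDensity_mul_dirDeriv_normalizedGrad hs hU hp, sub_mul, Finset.mul_sum,
      Finset.sum_mul]
    congr 1
    · ring
    · exact Finset.sum_congr rfl fun j _ => by ring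
  have h3 : ∑ j, normalizedGrad s e U j p * dirDeriv s τ (dirDeriv s (e j) U) p
      = areaDensity s e U p * ∑ j, normalizedGrad s e U j p * dirDeriv s (e j) S p
        + S p * ∑ j, normalizedGrad s e U j p *
          ∑ k, normalizedGrad s e U k p * dirDeriv s (e k) (dirDeriv s (e j) U) p := by
    rw [Finset.mul_sum, Finset.mul_sum, ← Finset.sum_add_distrib]
    exact Finset.sum_congr rfl fun j _ => by rw [h1]; ring
  rw [h3, h1 i]
  linear_combination (-S p) * h2

/-- The evolution of the mean curvature when `∂_τ U = √(1 + |∇U|²) S`. -/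
theorem dirDeriv_divNormalizedGrad_of_flow (hs : UniqueDiffOn ℝ s) (hs' : s ⊆ closure (interior s))
    (hU : ContDiffOn ℝ ∞ U s) {S : V → ℝ} (hS : ContDiffOn ℝ ∞ S s) {τ : V}
    (hflow : ∀ q ∈ s, dirDeriv s τ U q = areaDensity s e U q * S q) {p : V} (hp : p ∈ s) :
    dirDeriv s τ (divNormalizedGrad s e U) p
      = (∑ i, dirDeriv s (e i) (dirDeriv s (e i) S) p
          - ∑ i, ∑ j, normalizedGrad s e U i p * normalizedGrad s e U j p
              * dirDeriv s (e i) (dirDeriv s (e j) S) p)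
        - divNormalizedGrad s e U p * ∑ j, normalizedGrad s e U j p * dirDeriv s (e j) S p
        + S p * ∑ k, normalizedGrad s e U k p * dirDeriv s (e k) (divNormalizedGrad s e U) p
        + S p * ∑ i, ∑ k, dirDeriv s (e k) (normalizedGrad s e U i) p
            * dirDeriv s (e i) (normalizedGrad s e U k) p := by
  have hN := fun i => contDiffOn_normalizedGrad (e := e) hs hU i
  have hDN := fun i k => contDiffOn_dirDeriv hs (hN i) (e k)
  have hDS := fun j => contDiffOn_dirDeriv hs hS (e j)
  have hdiv : ∀ v, dirDeriv s v (divNormalizedGrad s e U) p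
      = ∑ i, dirDeriv s (e i) (dirDeriv s v (normalizedGrad s e U i)) p := by
    intro v
    have := dirDeriv_sum hs (fun i => hDN i i) hp v
    refine this.trans (Finset.sum_congr rfl fun i _ => dirDeriv_comm hs hs' (hN i) hp _ _)
  have hterm : ∀ i, dirDeriv s (e i) (dirDeriv s τ (normalizedGrad s e U i)) p
      = dirDeriv s (e i) (dirDeriv s (e i) S) p
        - (∑ j, normalizedGrad s e U i p * normalizedGrad s e U j p
              * dirDeriv s (e i) (dirDeriv s (e j) S) p)
        - ∑ j, normalizedGrad s e U i p * dirDeriv s (e i) (normalizedGrad s e U j) p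
              * dirDeriv s (e j) S p
        - dirDeriv s (e i) (normalizedGrad s e U i) p
            * ∑ j, normalizedGrad s e U j p * dirDeriv s (e j) S p
        + S p * ∑ k, normalizedGrad s e U k p
            * dirDeriv s (e i) (dirDeriv s (e k) (normalizedGrad s e U i)) p
        + S p * ∑ k, dirDeriv s (e k) (normalizedGrad s e U i) p
            * dirDeriv s (e i) (normalizedGrad s e U k) p
        + ∑ k, normalizedGrad s e U k p * dirDeriv s (e k) (normalizedGrad s e U i) p
            * dirDeriv s (e i) S p := by
    intro i
    have hA : ContDiffOn ℝ ∞
        (fun q => ∑ j, normalizedGrad s e U j q * dirDeriv s (e j) S q) s :=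
      ContDiffOn.sum fun j _ => (hN j).mul (hDS j)
    have hB : ContDiffOn ℝ ∞ (fun q => ∑ k, dirDeriv s (e k) (normalizedGrad s e U i) q
        * normalizedGrad s e U k q) s := ContDiffOn.sum fun k _ => (hDN i k).mul (hN k)
    rw [dirDeriv_congr (fun q hq => dirDeriv_normalizedGrad_of_flow hs hs' hU hS hflow hq i) hp,
      dirDeriv_add hs ((hDS i).sub ((hN i).mul hA)) (hS.mul hB) hp,
      dirDeriv_sub hs (hDS i) ((hN i).mul hA) hp, dirDeriv_mul hs (hN i) hA hp,
      dirDeriv_mul hs hS hB hp, dirDeriv_sum hs (fun j => (hN j).mul (hDS j)) hp,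
      dirDeriv_sum hs (fun k => (hDN i k).mul (hN k)) hp]
    simp only [fun j => dirDeriv_mul hs (hN j) (hDS j) hp (e i),
      fun k => dirDeriv_mul hs (hDN i k) (hN k) hp (e i), Finset.sum_add_distrib, mul_add,
      Finset.mul_sum]
    have h1 : ∀ k, dirDeriv s (e i) S p * (dirDeriv s (e k) (normalizedGrad s e U i) p
        * normalizedGrad s e U k p) = normalizedGrad s e U k p
          * dirDeriv s (e k) (normalizedGrad s e U i) p * dirDeriv s (e i) S p := by
      intro k; ring
    have h2 : ∀ k, dirDeriv s (e i) (dirDeriv s (e k) (normalizedGrad s e U i)) p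
        * normalizedGrad s e U k p = normalizedGrad s e U k p
          * dirDeriv s (e i) (dirDeriv s (e k) (normalizedGrad s e U i)) p := by
      intro k; ring
    simp only [h1, h2, mul_assoc]
    ring
  have hdivk : ∑ k, normalizedGrad s e U k p * dirDeriv s (e k) (divNormalizedGrad s e U) p
      = ∑ i, ∑ k, normalizedGrad s e U k p
            * dirDeriv s (e i) (dirDeriv s (e k) (normalizedGrad s e U i)) p := by
    rw [Finset.sum_comm]
    exact Finset.sum_congr rfl fun k _ => by rw [hdiv, Finset.mul_sum]
  -- After summation over i, the two terms pairing ∇N with N and ∇S differ only by exchanging the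
  -- indices, so they cancel.
  have hcancel : ∑ i, ∑ k, normalizedGrad s e U k p
        * dirDeriv s (e k) (normalizedGrad s e U i) p * dirDeriv s (e i) S p
      = ∑ i, ∑ j, normalizedGrad s e U i p * dirDeriv s (e i) (normalizedGrad s e U j) p
              * dirDeriv s (e j) S p := Finset.sum_comm
  rw [hdiv, Finset.sum_congr rfl fun i _ => hterm i]
  simp only [Finset.sum_add_distrib, Finset.sum_sub_distrib, ← Finset.mul_sum]
  rw [hcancel, hdivk, ← Finset.sum_mul, divNormalizedGrad]
  ring

end GraphEvolution

/-! ### Linear algebra of the inverse metric 1 - N Nᵀ. -/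

section RankOnePerturbation

variable {ι : Type*} [Fintype ι] [DecidableEq ι]

/-- An explicit symmetric square root of `1 - N Nᵀ` when `|N|² = 1 - W⁻²`. -/
theorem exists_symm_sqrt_one_sub_vecMulVec {N : ι → ℝ} {W : ℝ} (hW : 1 ≤ W)
    (hN : W * W * ∑ k, N k ^ 2 = W * W - 1) :
    ∃ Q : Matrix ι ι ℝ, Q.transpose = Q ∧ Q * Q = 1 - Matrix.vecMulVec N N := by
  have hdot : N ⬝ᵥ N = ∑ k, N k ^ 2 := by simp [dotProduct, sq]
  have hσ : N ⬝ᵥ N = (W * W - 1) / (W * W) := by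
    rw [hdot, eq_div_iff (by positivity)]; linarith
  -- The coefficient c = W / (1 + W) solves 2c - c² |N|² = 1.
  refine ⟨1 - (W / (1 + W)) • Matrix.vecMulVec N N, ?_, ?_⟩
  · simp [Matrix.transpose_vecMulVec]
  · simp only [sub_mul, mul_sub, one_mul, mul_one]
    rw [Matrix.smul_mul, Matrix.mul_smul,
      Matrix.vecMulVec_mul_vecMulVec, hσ]
    ext i j
    simp only [Matrix.sub_apply, Matrix.smul_apply, Matrix.vecMulVec_apply, smul_eq_mul,
      Pi.smul_apply]
    field_simp
    ring

theorem trace_one_sub_vecMulVec_mul (N : ι → ℝ) (A : Matrix ι ι ℝ) :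
    ((1 - Matrix.vecMulVec N N) * A).trace = ∑ i, A i i - ∑ i, ∑ j, N i * N j * A i j := by
  rw [sub_mul, one_mul, Matrix.trace_sub]
  congr 1
  simp only [Matrix.trace, Matrix.diag, Matrix.mul_apply, Matrix.vecMulVec_apply]
  rw [Finset.sum_comm]
  exact Finset.sum_congr rfl fun i _ => Finset.sum_congr rfl fun j _ => by ring

/-- With Q² = 1 - N Nᵀ and Q symmetric, the trace equals tr(Q F Q), a sum of values of the quadratic
form on the rows of Q. -/
theorem trace_nonneg_of_quadForm_nonneg {N : ι → ℝ} {W : ℝ} (hW : 1 ≤ W)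
    (hN : W * W * ∑ k, N k ^ 2 = W * W - 1) {F : ι → ι → ℝ}
    (hF : ∀ w : ι → ℝ, 0 ≤ ∑ i, ∑ j, w i * w j * F i j) :
    0 ≤ ∑ i, F i i - ∑ i, ∑ j, N i * N j * F i j := by
  obtain ⟨Q, hQt, hQ⟩ := exists_symm_sqrt_one_sub_vecMulVec hW hN
  have h := trace_one_sub_vecMulVec_mul N (Matrix.of F)
  simp only [Matrix.of_apply] at h
  rw [← h, ← hQ, Matrix.mul_assoc, Matrix.trace_mul_comm]
  refine Finset.sum_nonneg fun k _ => ?_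
  have hsymm : ∀ i j, Q i j = Q j i := fun i j => by
    conv_lhs => rw [← hQt, Matrix.transpose_apply]
  refine (hF (Q k)).trans_eq (Eq.symm ?_)
  simp only [Matrix.diag, Matrix.mul_apply, Matrix.of_apply, Finset.sum_mul]
  rw [Finset.sum_comm]
  refine Finset.sum_congr rfl fun i _ => Finset.sum_congr rfl fun j _ => ?_
  rw [hsymm j k]; ring

/-- Here W B = Q² A is similar in its traces to the symmetric matrix C = Q A Q: tr C = W tr B and tr
C² = W² tr B². Since tr C² is the sum of the squared entries of C, it can be nonpositive only if C =
0, contrary to tr B > 0. Applied to B = ∇N this gives |A|² > 0. -/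
theorem sum_mul_transpose_pos {N : ι → ℝ} {W : ℝ} (hW : 1 ≤ W)
    (hN : W * W * ∑ k, N k ^ 2 = W * W - 1) {A B : ι → ι → ℝ} (hA : ∀ i j, A i j = A j i)
    (hB : ∀ i k, W * B i k = A i k - N i * ∑ j, N j * A j k) (htr : 0 < ∑ i, B i i) :
    0 < ∑ i, ∑ k, B i k * B k i := by
  obtain ⟨Q, hQt, hQ⟩ := exists_symm_sqrt_one_sub_vecMulVec hW hN
  have hAt : (Matrix.of A).transpose = Matrix.of A := by
    ext i j; exact hA j i
  have hWB : W • Matrix.of B = Q * Q * Matrix.of A := by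
    ext i k
    rw [hQ, sub_mul, one_mul]
    simp [Matrix.mul_apply, Matrix.vecMulVec_apply, hB, Finset.mul_sum, mul_assoc]
  set C : Matrix ι ι ℝ := Q * Matrix.of A * Q with hC
  have hCt : C.transpose = C := by
    simp only [hC, Matrix.transpose_mul, hQt, hAt, Matrix.mul_assoc]
  have htrC : C.trace = W * ∑ i, B i i := by
    have h1 : C.trace = (W • Matrix.of B).trace := by
      rw [hWB, hC, Matrix.trace_mul_comm, ← Matrix.mul_assoc]
    rw [h1, Matrix.trace_smul]; rfl
  have htrCC : (C * C.transpose).trace = W * W * ∑ i, ∑ k, B i k * B k i := by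
    have h1 : (C * C).trace = ((W • Matrix.of B) * (W • Matrix.of B)).trace := by
      have e1 : C * C = Q * (Matrix.of A * Q * Q * Matrix.of A * Q) := by
        simp only [hC, Matrix.mul_assoc]
      have e2 : Q * Q * Matrix.of A * (Q * Q * Matrix.of A)
          = Q * Q * (Matrix.of A * Q * Q * Matrix.of A) := by simp only [Matrix.mul_assoc]
      rw [hWB, e1, e2, Matrix.trace_mul_comm Q, Matrix.trace_mul_comm (Q * Q)]
      simp only [Matrix.mul_assoc]
    rw [hCt, h1, Matrix.smul_mul, Matrix.mul_smul, Matrix.trace_smul, Matrix.trace_smul,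
      smul_eq_mul, smul_eq_mul, mul_assoc]
    rfl
  have hsq : (C * C.transpose).trace = ∑ i, ∑ j, C i j ^ 2 := by
    simp [Matrix.trace, Matrix.mul_apply, sq]
  have hWW : 0 < W * W := by positivity
  by_contra! hneg
  have hle : ∑ i, ∑ j, C i j ^ 2 ≤ 0 := by
    rw [← hsq, htrCC]; exact mul_nonpos_of_nonneg_of_nonpos hWW.le hneg
  have hzero : ∀ i, C i i = 0 := by
    intro i
    have h1 : C i i ^ 2 ≤ ∑ i, ∑ j, C i j ^ 2 :=
      (Finset.single_le_sum (f := fun j => C i j ^ 2) (fun j _ => sq_nonneg _)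
        (Finset.mem_univ i)).trans
      (Finset.single_le_sum (f := fun i => ∑ j, C i j ^ 2)
        (fun i _ => Finset.sum_nonneg fun j _ => sq_nonneg _) (Finset.mem_univ i))
    exact pow_eq_zero_iff two_ne_zero |>.1 (le_antisymm (h1.trans hle) (sq_nonneg _))
  have : C.trace = 0 := Finset.sum_eq_zero fun i _ => hzero i
  rw [htrC] at this
  have : 0 < W * ∑ i, B i i := by positivity
  linarith

end RankOnePerturbation

/-! ### The contradiction at an interior touching point. -/

section Touching

variable {V : Type*} [NormedAddCommGroup V] [NormedSpace ℝ V] {s : Set V}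
  {ι : Type*} [Fintype ι] {e : ι → V} {U : V → ℝ}

theorem areaDensity_mul_divNormalizedGrad (hs : UniqueDiffOn ℝ s) (hU : ContDiffOn ℝ ∞ U s)
    {p : V} (hp : p ∈ s) :
    areaDensity s e U p * divNormalizedGrad s e U p
      = ∑ i, dirDeriv s (e i) (dirDeriv s (e i) U) p
        - ∑ i, ∑ j, normalizedGrad s e U i p * normalizedGrad s e U j p
            * dirDeriv s (e i) (dirDeriv s (e j) U) p := by
  rw [divNormalizedGrad, Finset.mul_sum, ← Finset.sum_sub_distrib]
  refine Finset.sum_congr rfl fun i _ => ?_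
  rw [areaDensity_mul_dirDeriv_normalizedGrad hs hU hp, Finset.mul_sum]
  simp only [mul_assoc]

theorem sum_dirDeriv_normalizedGrad_mul_pos (hs : UniqueDiffOn ℝ s)
    (hs' : s ⊆ closure (interior s)) (hU : ContDiffOn ℝ ∞ U s) {p : V} (hp : p ∈ s)
    (hH : 0 < divNormalizedGrad s e U p) :
    0 < ∑ i, ∑ k, dirDeriv s (e k) (normalizedGrad s e U i) p
            * dirDeriv s (e i) (normalizedGrad s e U k) p := by
  classical
  refine sum_mul_transpose_pos (one_le_areaDensity (s := s) (e := e) (U := U) p)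
    (areaDensity_mul_self_mul_sum_sq p)
    (A := fun i k => dirDeriv s (e k) (dirDeriv s (e i) U) p)
    (B := fun i k => dirDeriv s (e k) (normalizedGrad s e U i) p)
    (fun i j => dirDeriv_comm hs hs' hU hp _ _) (fun i k => ?_) hH
  exact areaDensity_mul_dirDeriv_normalizedGrad hs hU hp _ _

/-- A solution of the graphical `H^α`-flow admits no interior point at which
`H^α - m (a - b t - U)` satisfies the first and second order conditions for a minimum. -/
theorem false_of_touching (hs : UniqueDiffOn ℝ s) (hs' : s ⊆ closure (interior s))
    (hU : ContDiffOn ℝ ∞ U s) {α a b m : ℝ} (hα : 0 < α) (hb : 0 ≤ b) (hm : 0 < m) {τ : V}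
    (l : V →L[ℝ] ℝ) (hlτ : l τ = 1) (hle : ∀ i, l (e i) = 0)
    (hH : ∀ q ∈ s, 0 < divNormalizedGrad s e U q)
    (hflow : ∀ q ∈ s, dirDeriv s τ U q = areaDensity s e U q * divNormalizedGrad s e U q ^ α)
    {p : V} (hp : p ∈ s) {f : V → ℝ}
    (hf : ∀ q, f q = divNormalizedGrad s e U q ^ α - m * (a - b * l q - U q))
    (hgrad : ∀ i, dirDeriv s (e i) f p = 0)
    (hhess : ∀ c : ι → ℝ, 0 ≤ dirDeriv s (∑ i, c i • e i) (dirDeriv s (∑ i, c i • e i) f) p)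
    (htime : dirDeriv s τ f p ≤ 0)
    (hcase : α ≤ 1 ∨ (α - 1) * divNormalizedGrad s e U p ^ α ≤ b) : False := by
  classical
  set S : V → ℝ := fun q => divNormalizedGrad s e U q ^ α
  have hHs : ContDiffOn ℝ ∞ (divNormalizedGrad s e U) s := contDiffOn_divNormalizedGrad hs hU
  have hS : ContDiffOn ℝ ∞ S s := hHs.rpow_const_of_ne fun q hq => (hH q hq).ne'
  have hψ : ContDiffOn ℝ ∞ (fun q => a - b * l q - U q) s :=
    (contDiffOn_const.sub (contDiffOn_const.mul l.contDiff.contDiffOn)).sub hU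
  have hfs : ContDiffOn ℝ ∞ f s := by
    rw [funext hf]; exact hS.sub (contDiffOn_const.mul hψ)
  have hDf : ∀ v, ∀ q ∈ s, dirDeriv s v f q
      = dirDeriv s v S q + m * (b * l v + dirDeriv s v U q) := by
    intro v q hq
    have h1 : HasFDerivWithinAt f (fderivWithin ℝ S s q
        - m • ((0 - b • l) - fderivWithin ℝ U s q)) s q := by
      rw [funext hf]
      exact (smooth_hasFDerivWithinAt hS hq).sub
        ((((hasFDerivWithinAt_const a q s).sub
          (l.hasFDerivWithinAt.const_mul b)).sub (smooth_hasFDerivWithinAt hU hq)).const_mul m)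
    rw [dirDeriv_eq_of_hasFDerivWithinAt hs hq h1]
    simp [dirDeriv]
    ring
  have hDDf : ∀ i j, dirDeriv s (e i) (dirDeriv s (e j) f) p
      = dirDeriv s (e i) (dirDeriv s (e j) S) p + m * dirDeriv s (e i) (dirDeriv s (e j) U) p := by
    intro i j
    have hUj := contDiffOn_dirDeriv hs hU (e j)
    rw [dirDeriv_congr (fun q hq => hDf (e j) q hq) hp]
    simp only [hle, mul_zero, zero_add]
    rw [dirDeriv_add hs (contDiffOn_dirDeriv hs hS _) (contDiffOn_const.mul hUj) hp,
      dirDeriv_mul hs contDiffOn_const hUj hp, dirDeriv_const]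
    ring
  -- The Hessian condition on f, contracted with the inverse metric.
  have hG := trace_nonneg_of_quadForm_nonneg (one_le_areaDensity (s := s) (e := e) (U := U) p)
    (areaDensity_mul_self_mul_sum_sq p)
    (F := fun i j => dirDeriv s (e i) (dirDeriv s (e j) f) p)
    (fun w => by rw [← dirDeriv_dirDeriv_linearCombination hs w e hfs hp]; exact hhess w)
  simp only [hDDf, mul_add, Finset.sum_add_distrib] at hG
  have hWH := areaDensity_mul_divNormalizedGrad (e := e) hs hU hp
  have hT := sum_dirDeriv_normalizedGrad_mul_pos hs hs' hU hp (hH p hp)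
  have hevol := dirDeriv_divNormalizedGrad_of_flow hs hs' hU hS hflow hp
  have hσ := areaDensity_mul_self_mul_sum_sq (s := s) (e := e) (U := U) p
  have hWge := one_le_areaDensity (s := s) (e := e) (U := U) p
  have hDS : ∀ v, dirDeriv s v S p
      = α * divNormalizedGrad s e U p ^ (α - 1) * dirDeriv s v (divNormalizedGrad s e U) p :=
    fun v => dirDeriv_rpow hs hHs α hp (hH p hp).ne' v
  -- The vanishing gradient of f determines ∇S = -m W N at p.
  have hDiS : ∀ i, dirDeriv s (e i) S p
      = -(m * areaDensity s e U p) * normalizedGrad s e U i p := by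
    intro i
    have h1 := hDf (e i) p hp
    rw [hgrad, hle, dirDeriv_eq_areaDensity_mul (U := U) i p] at h1
    linarith
  have hτ := hDf τ p hp
  rw [hflow p hp, hlτ] at hτ
  have hNDS : ∑ j, normalizedGrad s e U j p * dirDeriv s (e j) S p
      = -(m * areaDensity s e U p) * ∑ k, normalizedGrad s e U k p ^ 2 := by
    rw [Finset.mul_sum]
    exact Finset.sum_congr rfl fun j _ => by rw [hDiS]; ring
  have hNDH : α * divNormalizedGrad s e U p ^ (α - 1)
        * ∑ k, normalizedGrad s e U k p * dirDeriv s (e k) (divNormalizedGrad s e U) p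
      = -(m * areaDensity s e U p) * ∑ k, normalizedGrad s e U k p ^ 2 := by
    rw [← hNDS, Finset.mul_sum]
    exact Finset.sum_congr rfl fun j _ => by rw [hDS]; ring
  have hKH : α * divNormalizedGrad s e U p ^ (α - 1) * divNormalizedGrad s e U p = α * S p := by
    rw [mul_assoc, ← Real.rpow_add_one (hH p hp).ne', sub_add_cancel]
  have hSp : 0 < S p := Real.rpow_pos_of_pos (hH p hp) α
  have hK : 0 < α * divNormalizedGrad s e U p ^ (α - 1) :=
    mul_pos hα (Real.rpow_pos_of_pos (hH p hp) _)
  rw [hDS] at hτ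
  have hmG : ∑ i, ∑ j, normalizedGrad s e U i p * normalizedGrad s e U j p
        * (m * dirDeriv s (e i) (dirDeriv s (e j) U) p)
      = m * ∑ i, ∑ j, normalizedGrad s e U i p * normalizedGrad s e U j p
        * dirDeriv s (e i) (dirDeriv s (e j) U) p := by
    simp only [Finset.mul_sum]
    exact Finset.sum_congr rfl fun i _ => Finset.sum_congr rfl fun j _ => by ring
  rw [hmG, ← Finset.mul_sum] at hG
  rw [hNDS] at hevol
  change (α ≤ 1 ∨ (α - 1) * S p ≤ b) at hcase
  change _ = _ + m * (b * 1 + areaDensity s e U p * S p) at hτ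
  generalize divNormalizedGrad s e U p ^ (α - 1) = R at *
  generalize hKdef : α * R = K at *
  generalize areaDensity s e U p = W at *
  generalize divNormalizedGrad s e U p = H at *
  generalize S p = σS at *
  generalize ∑ k, normalizedGrad s e U k p ^ 2 = σ at *
  generalize ∑ k, normalizedGrad s e U k p * dirDeriv s (e k) (divNormalizedGrad s e U) p = ν at *
  generalize (∑ i, ∑ k, dirDeriv s (e k) (normalizedGrad s e U i) p
            * dirDeriv s (e i) (normalizedGrad s e U k) p) = T at *
  generalize dirDeriv s τ (divNormalizedGrad s e U) p = Hτ at *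
  -- The traced Hessian inequality times K = α H^(α-1): second derivatives of S are eliminated by
  -- the evolution of H, those of U by the formula for W H.
  have hG' : 0 ≤ K * (Hτ + H * (-(m * W) * σ) - σS * ν - σS * T + m * (W * H)) := by
    refine mul_nonneg hK.le ?_
    rw [hWH, hevol]
    linarith
  -- As σ = |N|², the quantity θ = W (1 - σ) is 1 / W and lies in (0, 1].
  have hθ : W * (W * (1 - σ)) = 1 := by linarith
  have hθ0 : 0 < W * (1 - σ) := by
    by_contra! h
    have := mul_nonpos_of_nonneg_of_nonpos (zero_le_one.trans hWge) h
    linarith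
  have hθ1 : W * (1 - σ) ≤ 1 := by
    have := le_mul_of_one_le_left hθ0.le hWge
    rwa [hθ] at this
  generalize hθdef : W * (1 - σ) = θ at *
  have hmain : m * b + (1 - α) * (m * σS * θ) + K * (σS * T) ≤ 0 := by
    have e1 : K * (Hτ + H * (-(m * W) * σ) - σS * ν - σS * T + m * (W * H))
        = K * Hτ + (K * H) * (m * W) * (1 - σ) - σS * (K * ν) - K * (σS * T) := by ring
    rw [e1, hKH, hNDH] at hG'
    have e2 : m * σS * θ = m * σS * W * (1 - σ) := by rw [← hθdef]; ring
    rw [e2]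
    linarith
  have hpos : 0 < K * (σS * T) := mul_pos hK (mul_pos hSp hT)
  have hmb : 0 ≤ m * b := mul_nonneg hm.le hb
  have hmS : 0 < m * σS * θ := mul_pos (mul_pos hm hSp) hθ0
  rcases le_or_gt α 1 with h | h
  · have := mul_nonneg (sub_nonneg.2 h) hmS.le
    linarith
  · have h2 : (α - 1) * σS ≤ b := hcase.resolve_left (not_le.2 h)
    have h3 : (α - 1) * σS * θ ≤ (α - 1) * σS :=
      mul_le_of_le_one_right (mul_nonneg (sub_nonneg.2 h.le) hSp.le) hθ1
    have h4 : m * ((α - 1) * σS * θ) ≤ m * b := mul_le_mul_of_nonneg_left (h3.trans h2) hm.le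
    linarith

end Touching

/-! ### The space-time region below a height, and the flow equation on it. -/

section SpaceTimeDomain

variable {n : ℕ} {u : EuclideanSpace ℝ (Fin n) → ℝ → EReal} {α h : ℝ}

/-- The function `u` on space-time, with real values. -/
noncomputable def spaceTime (u : EuclideanSpace ℝ (Fin n) → ℝ → EReal)
    (p : EuclideanSpace ℝ (Fin n) × ℝ) : ℝ := slice u p.2 p.1

/-- The coordinate directions of space, in space-time. -/
noncomputable def spaceDir (i : Fin n) : EuclideanSpace ℝ (Fin n) × ℝ :=
  (EuclideanSpace.single i 1, 0)

/-- Since min(u, h) < h exactly when u < h, continuity of the truncation makes the region relatively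
open in t ≥ 0. -/
theorem exists_isOpen_below_eq (hu : IsHAlphaFlowBelow α h u) :
    ∃ O : Set (EuclideanSpace ℝ (Fin n) × ℝ), IsOpen O ∧ below u h = O ∩ {p | 0 ≤ p.2} := by
  obtain ⟨O, hO, hOe⟩ := continuousOn_iff'.1 hu.continuousOn (Set.Iio (h : EReal)) isOpen_Iio
  refine ⟨O, hO, hOe ▸ ?_⟩
  ext p
  simp [below, and_comm]

theorem uniqueDiffOn_below (hu : IsHAlphaFlowBelow α h u) : UniqueDiffOn ℝ (below u h) := by
  obtain ⟨O, hO, hOe⟩ := exists_isOpen_below_eq hu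
  have h1 : {p : EuclideanSpace ℝ (Fin n) × ℝ | 0 ≤ p.2} = Set.univ ×ˢ Set.Ici 0 := by
    ext p; simp
  rw [hOe, Set.inter_comm, h1]
  exact (uniqueDiffOn_univ.prod (uniqueDiffOn_Ici 0)).inter hO

theorem below_subset_closure_interior (hu : IsHAlphaFlowBelow α h u) :
    below u h ⊆ closure (interior (below u h)) := by
  obtain ⟨O, hO, hOe⟩ := exists_isOpen_below_eq hu
  have h1 : {p : EuclideanSpace ℝ (Fin n) × ℝ | 0 ≤ p.2} = Set.univ ×ˢ Set.Ici 0 := by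
    ext p; simp
  have h2 : {p : EuclideanSpace ℝ (Fin n) × ℝ | 0 ≤ p.2}
      ⊆ closure (interior {p : EuclideanSpace ℝ (Fin n) × ℝ | 0 ≤ p.2}) := by
    rw [h1, interior_prod_eq, interior_univ, interior_Ici, closure_prod_eq, closure_univ,
      closure_Ioi]
  rw [hOe, interior_inter, hO.interior_eq]
  exact (Set.inter_subset_inter_right O h2).trans hO.inter_closure

theorem below_mem_nhds (hu : IsHAlphaFlowBelow α h u) {p : EuclideanSpace ℝ (Fin n) × ℝ}
    (hp : p ∈ below u h) (ht : 0 < p.2) : below u h ∈ nhds p := by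
  obtain ⟨O, hO, hOe⟩ := exists_isOpen_below_eq hu
  rw [hOe] at hp ⊢
  refine Filter.inter_mem (hO.mem_nhds hp.1) ?_
  filter_upwards [continuous_snd.continuousAt.eventually (lt_mem_nhds ht)] with q hq using hq.le

theorem eventually_mem_below_space (hu : IsHAlphaFlowBelow α h u)
    {x : EuclideanSpace ℝ (Fin n)} {t : ℝ} (hp : (x, t) ∈ below u h) :
    ∀ᶠ y in nhds x, (y, t) ∈ below u h := by
  obtain ⟨O, hO, hOe⟩ := exists_isOpen_below_eq hu
  rw [hOe] at hp ⊢
  have hc : Continuous fun y : EuclideanSpace ℝ (Fin n) => (y, t) := by fun_prop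
  filter_upwards [hc.continuousAt.eventually (hO.mem_nhds hp.1)] with y hy using ⟨hy, hp.2⟩

theorem eventually_mem_below_time (hu : IsHAlphaFlowBelow α h u)
    {x : EuclideanSpace ℝ (Fin n)} {t : ℝ} (hp : (x, t) ∈ below u h) :
    ∀ᶠ r in nhdsWithin t (Set.Ici 0), (x, r) ∈ below u h := by
  obtain ⟨O, hO, hOe⟩ := exists_isOpen_below_eq hu
  rw [hOe] at hp ⊢
  have hc : Continuous fun r : ℝ => (x, r) := by fun_prop
  filter_upwards [self_mem_nhdsWithin,
    (hc.continuousAt.eventually (hO.mem_nhds hp.1)).filter_mono nhdsWithin_le_nhds] with r hr hr'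
    using ⟨hr', hr⟩

theorem contDiffOn_spaceTime (hu : IsHAlphaFlowBelow α h u) :
    ContDiffOn ℝ ∞ (spaceTime u) (below u h) := hu.smooth

/-- Time slices of the region are open in space even at t = 0, so a derivative within the region
restricts to a genuine spatial derivative. -/
theorem hasFDerivAt_restrict_space (hu : IsHAlphaFlowBelow α h u)
    {g : EuclideanSpace ℝ (Fin n) × ℝ → ℝ} (hg : ContDiffOn ℝ ∞ g (below u h))
    {x : EuclideanSpace ℝ (Fin n)} {t : ℝ} (hp : (x, t) ∈ below u h) :
    HasFDerivAt (fun y => g (y, t)) ((fderivWithin ℝ g (below u h) (x, t)).comp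
      (ContinuousLinearMap.inl ℝ (EuclideanSpace ℝ (Fin n)) ℝ)) x := by
  have h1 : HasFDerivWithinAt (fun y : EuclideanSpace ℝ (Fin n) => (y, t))
      (ContinuousLinearMap.inl ℝ (EuclideanSpace ℝ (Fin n)) ℝ) {y | (y, t) ∈ below u h} x :=
    (hasFDerivAt_prodMk_left x t).hasFDerivWithinAt
  have h2 := HasFDerivWithinAt.comp x (smooth_hasFDerivWithinAt hg hp) h1 (fun y hy => hy)
  exact h2.hasFDerivAt (eventually_mem_below_space hu hp)

theorem gradient_slice_apply (hu : IsHAlphaFlowBelow α h u)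
    {x : EuclideanSpace ℝ (Fin n)} {t : ℝ} (hp : (x, t) ∈ below u h) (i : Fin n) :
    gradient (slice u t) x i = dirDeriv (below u h) (spaceDir i) (spaceTime u) (x, t) := by
  have h1 : inner ℝ (gradient (slice u t) x) (EuclideanSpace.single i (1 : ℝ))
      = gradient (slice u t) x i := by
    rw [EuclideanSpace.inner_single_right]; simp
  rw [← h1, inner_gradient_left]
  have h2 : HasFDerivAt (slice u t) _ x :=
    hasFDerivAt_restrict_space hu (contDiffOn_spaceTime hu) hp
  rw [h2.fderiv]
  simp [dirDeriv, spaceDir]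

theorem areaElement_slice (hu : IsHAlphaFlowBelow α h u)
    {x : EuclideanSpace ℝ (Fin n)} {t : ℝ} (hp : (x, t) ∈ below u h) :
    areaElement (slice u t) x = areaDensity (below u h) spaceDir (spaceTime u) (x, t) := by
  rw [areaElement, areaDensity, EuclideanSpace.real_norm_sq_eq]
  simp only [gradient_slice_apply hu hp]

theorem graphMeanCurvature_slice (hu : IsHAlphaFlowBelow α h u)
    {x : EuclideanSpace ℝ (Fin n)} {t : ℝ} (hp : (x, t) ∈ below u h) :
    graphMeanCurvature (slice u t) x
      = divNormalizedGrad (below u h) spaceDir (spaceTime u) (x, t) := by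
  set F : EuclideanSpace ℝ (Fin n) → EuclideanSpace ℝ (Fin n) :=
    fun y => (areaElement (slice u t) y)⁻¹ • gradient (slice u t) y with hF
  have hcomp : ∀ i, HasFDerivAt (fun y => F y i)
      ((fderivWithin ℝ (normalizedGrad (below u h) spaceDir (spaceTime u) i) (below u h)
        (x, t)).comp (ContinuousLinearMap.inl ℝ (EuclideanSpace ℝ (Fin n)) ℝ)) x := by
    intro i
    refine (hasFDerivAt_restrict_space hu (contDiffOn_normalizedGrad (uniqueDiffOn_below hu)
      (contDiffOn_spaceTime hu) i) hp).congr_of_eventuallyEq ?_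
    filter_upwards [eventually_mem_below_space hu hp] with y hy
    simp only [hF, PiLp.smul_apply, smul_eq_mul, areaElement_slice hu hy,
      gradient_slice_apply hu hy, normalizedGrad]
  have hdiff : DifferentiableAt ℝ F x :=
    differentiableAt_euclidean.2 fun i => (hcomp i).differentiableAt
  refine Finset.sum_congr rfl fun i _ => ?_
  have h1 := (hasFDerivWithinAt_euclidean.1 hdiff.hasFDerivAt.hasFDerivWithinAt i :
    HasFDerivWithinAt (fun y => F y i) _ Set.univ x)
  have h2 := (hasFDerivWithinAt_univ.1 h1).unique (hcomp i)
  have h3 := DFunLike.congr_fun h2 (EuclideanSpace.single i (1 : ℝ))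
  simpa [dirDeriv, spaceDir] using h3

theorem dirDeriv_time_spaceTime (hu : IsHAlphaFlowBelow α h u)
    {p : EuclideanSpace ℝ (Fin n) × ℝ} (hp : p ∈ below u h) :
    dirDeriv (below u h) (0, 1) (spaceTime u) p
      = areaDensity (below u h) spaceDir (spaceTime u) p
        * divNormalizedGrad (below u h) spaceDir (spaceTime u) p ^ α := by
  obtain ⟨x, t⟩ := p
  have h1 : HasFDerivWithinAt (fun r : ℝ => (x, r))
      (ContinuousLinearMap.inr ℝ (EuclideanSpace ℝ (Fin n)) ℝ) {r | (x, r) ∈ below u h} t :=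
    (hasFDerivAt_prodMk_right x t).hasFDerivWithinAt
  have h2 := (HasFDerivWithinAt.comp t
    (smooth_hasFDerivWithinAt (contDiffOn_spaceTime hu) hp) h1 (fun y hy => hy)).hasDerivWithinAt
  have h3 := h2.mono_of_mem_nhdsWithin (eventually_mem_below_time hu hp)
  have h4 := hu.flow _ hp
  rw [areaElement_slice hu hp, graphMeanCurvature_slice hu hp] at h4
  rw [← UniqueDiffWithinAt.eq_deriv _ (uniqueDiffOn_Ici (0 : ℝ) t hp.1) h3 h4]
  simp [dirDeriv]

theorem divNormalizedGrad_pos (hu : IsHAlphaFlowBelow α h u)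
    {p : EuclideanSpace ℝ (Fin n) × ℝ} (hp : p ∈ below u h) :
    0 < divNormalizedGrad (below u h) spaceDir (spaceTime u) p := by
  have := hu.meanCurvature_pos p hp
  rwa [graphMeanCurvature_slice hu hp] at this

theorem coe_spaceTime (hu0 : ∀ x, ∀ t, 0 ≤ t → 0 ≤ u x t) {p : EuclideanSpace ℝ (Fin n) × ℝ}
    (hp : p ∈ below u h) : (spaceTime u p : EReal) = u p.1 p.2 :=
  EReal.coe_toReal (hp.2.trans (EReal.coe_lt_top h)).ne
    (EReal.bot_lt_zero.trans_le (hu0 p.1 p.2 hp.1)).ne'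

/-- The flow moves upwards. -/
theorem monotone_in_time (hu0 : ∀ x, ∀ t, 0 ≤ t → 0 ≤ u x t) (hu : IsHAlphaFlowBelow α h u)
    {x : EuclideanSpace ℝ (Fin n)} {r t : ℝ} (hr : 0 ≤ r) (hrt : r ≤ t) (hp : u x t < h) :
    u x r ≤ u x t := by
  have hcont : ContinuousOn (fun τ => min (u x τ) (h : EReal)) (Set.Icc r t) :=
    hu.continuousOn.comp (f := fun τ : ℝ => (x, τ)) (by fun_prop) fun τ hτ => hr.trans hτ.1
  -- A minimizer τ > r would have a nonpositive left time derivative, against the positive speed;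
  -- hence τ = r.
  obtain ⟨τ, hτ, hmin⟩ := isCompact_Icc.exists_isMinOn (Set.nonempty_Icc.2 hrt) hcont
  have hmin' : ∀ σ ∈ Set.Icc r t, min (u x τ) (h : EReal) ≤ min (u x σ) h := fun σ hσ => hmin hσ
  have hτh : u x τ < h := by
    have := (hmin' t (Set.right_mem_Icc.2 hrt)).trans_lt ((min_le_left _ _).trans_lt hp)
    exact (min_lt_iff.1 this).resolve_right (lt_irrefl _)
  have hτ0 := hr.trans hτ.1
  have hτb : (x, τ) ∈ below u h := ⟨hτ0, hτh⟩
  rcases hτ.1.eq_or_lt with heq | hlt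
  · have := hmin' t (Set.right_mem_Icc.2 hrt)
    rw [← heq] at this hτh
    rwa [min_eq_left hτh.le, min_eq_left hp.le] at this
  · exfalso
    have hτpos := hr.trans_lt hlt
    have hder := hu.flow _ hτb
    rw [areaElement_slice hu hτb, graphMeanCurvature_slice hu hτb] at hder
    have hle : nhdsWithin τ (Set.Iio τ) ≤ nhdsWithin τ (Set.Ici 0) := by
      refine nhdsWithin_le_iff.2 ?_
      exact mem_nhdsWithin_of_mem_nhds (Ici_mem_nhds hτpos)
    have hder' : HasDerivWithinAt (fun σ => slice u σ x) _ (Set.Iio τ) τ :=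
      hder.mono_of_mem_nhdsWithin (mem_nhdsWithin_of_mem_nhds (Ici_mem_nhds hτpos))
    have := nonpos_of_hasDerivWithinAt_of_left_min hder' (by
      filter_upwards [(eventually_mem_below_time hu hτb).filter_mono hle, self_mem_nhdsWithin,
        mem_nhdsWithin_of_mem_nhds (Ici_mem_nhds hlt)] with σ hσb hστ hrσ
      have h1 := hmin' σ ⟨hrσ, (le_of_lt hστ).trans hτ.2⟩
      rw [min_eq_left hτh.le, min_eq_left hσb.2.le] at h1
      exact EReal.toReal_le_toReal h1 (EReal.bot_lt_zero.trans_le (hu0 x τ hτ0)).ne'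
        (hσb.2.trans (EReal.coe_lt_top h)).ne)
    exact absurd this (not_le.2 (mul_pos (areaDensity_pos _)
      (Real.rpow_pos_of_pos (divNormalizedGrad_pos hu hτb) _)))

/-- Closedness comes from the truncated function, since a < h makes the truncation invisible at
level a. Monotonicity in time confines the set to the initial sublevel set times [0, T]. -/
theorem isCompact_sublevel (hu0 : ∀ x, ∀ t, 0 ≤ t → 0 ≤ u x t) (hu : IsHAlphaFlowBelow α h u)
    {a : ℝ} (hah : a < h) (hK : IsCompact {x | u x 0 ≤ (a : EReal)}) (T : ℝ) :
    IsCompact {p : EuclideanSpace ℝ (Fin n) × ℝ | 0 ≤ p.2 ∧ p.2 ≤ T ∧ u p.1 p.2 ≤ a} := by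
  have hah' : (a : EReal) < h := EReal.coe_lt_coe hah
  refine (hK.prod (isCompact_Icc (a := 0) (b := T))).of_isClosed_subset ?_ ?_
  · have h1 := hu.continuousOn.preimage_isClosed_of_isClosed
      (isClosed_le continuous_const continuous_snd) (isClosed_Iic (a := (a : EReal)))
    have h2 : IsClosed {p : EuclideanSpace ℝ (Fin n) × ℝ | p.2 ≤ T} :=
      isClosed_le continuous_snd continuous_const
    convert h1.inter h2 using 1
    ext p
    simp only [Set.mem_ofPred_eq, Set.mem_inter_iff, Set.mem_preimage, Set.mem_Iic, min_le_iff,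
      not_le.2 hah', or_false]
    tauto
  · rintro ⟨x, t⟩ ⟨h0, hT, ha⟩
    exact ⟨(monotone_in_time hu0 hu le_rfl h0 (lt_of_le_of_lt ha hah')).trans ha, h0, hT⟩

end SpaceTimeDomain

/-! ### The minimum principle for the ratio and its consequences. -/

section MinimumPrinciple

variable {n : ℕ} {u : EuclideanSpace ℝ (Fin n) → ℝ → EReal} {α a b : ℝ}

/-- The function `a - b t - u` on space-time. -/
noncomputable def heightGap (a b : ℝ) (u : EuclideanSpace ℝ (Fin n) → ℝ → EReal)
    (p : EuclideanSpace ℝ (Fin n) × ℝ) : ℝ := a - b * p.2 - spaceTime u p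

/-- The speed `H^α` on space-time. -/
noncomputable def flowSpeed (α h : ℝ) (u : EuclideanSpace ℝ (Fin n) → ℝ → EReal)
    (p : EuclideanSpace ℝ (Fin n) × ℝ) : ℝ :=
  divNormalizedGrad (below u h) spaceDir (spaceTime u) p ^ α

theorem flowSpeed_pos {h : ℝ} (hu : IsHAlphaFlowBelow α h u) {p : EuclideanSpace ℝ (Fin n) × ℝ}
    (hp : p ∈ below u h) : 0 < flowSpeed α h u p :=
  Real.rpow_pos_of_pos (divNormalizedGrad_pos hu hp) _

theorem continuousOn_flowSpeed {h : ℝ} (hu : IsHAlphaFlowBelow α h u) :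
    ContinuousOn (flowSpeed α h u) (below u h) :=
  ((contDiffOn_divNormalizedGrad (uniqueDiffOn_below hu)
    (contDiffOn_spaceTime hu)).rpow_const_of_ne fun _ hq =>
      (divNormalizedGrad_pos hu hq).ne').continuousOn

theorem continuousOn_heightGap {h : ℝ} (hu : IsHAlphaFlowBelow α h u) :
    ContinuousOn (heightGap a b u) (below u h) :=
  ContinuousOn.sub (by fun_prop) (contDiffOn_spaceTime hu).continuousOn

theorem heightGap_le (hu0 : ∀ x, ∀ t, 0 ≤ t → 0 ≤ u x t) (hb : 0 ≤ b) {h : ℝ}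
    {p : EuclideanSpace ℝ (Fin n) × ℝ} (hp : p ∈ below u h) : heightGap a b u p ≤ a := by
  have h1 : (0 : ℝ) ≤ spaceTime u p := EReal.toReal_nonneg (hu0 _ _ hp.1)
  have h2 := mul_nonneg hb hp.1
  rw [heightGap]; linarith

theorem le_of_heightGap_pos (hu0 : ∀ x, ∀ t, 0 ≤ t → 0 ≤ u x t) (hb : 0 ≤ b) {h : ℝ}
    {p : EuclideanSpace ℝ (Fin n) × ℝ} (hp : p ∈ below u h) (hgap : 0 < heightGap a b u p) :
    u p.1 p.2 ≤ a := by
  rw [← coe_spaceTime hu0 hp, EReal.coe_le_coe_iff]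
  have h2 := mul_nonneg hb hp.1
  rw [heightGap] at hgap; linarith

/-- Minimum principle for `H^α / (a - b t - u)`. -/
theorem exists_initial_ratio_le (hα : 0 < α) (hb : 0 ≤ b)
    (hu0 : ∀ x, ∀ t, 0 ≤ t → 0 ≤ u x t) (hK : IsCompact {x | u x 0 ≤ (a : EReal)}) {h : ℝ}
    (hah : a < h) (hu : IsHAlphaFlowBelow α h u) {p₁ : EuclideanSpace ℝ (Fin n) × ℝ}
    (hp₁ : p₁ ∈ below u h) (hgap₁ : 0 < heightGap a b u p₁)
    (hcase : α ≤ 1 ∨ (α - 1) * (flowSpeed α h u p₁ / heightGap a b u p₁ * a) ≤ b) :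
    ∃ p ∈ below u h, p.2 = 0 ∧ 0 < heightGap a b u p ∧
      flowSpeed α h u p / heightGap a b u p ≤ flowSpeed α h u p₁ / heightGap a b u p₁ := by
  set q : ℝ := flowSpeed α h u p₁ / heightGap a b u p₁ with hq
  have hqpos : 0 < q := div_pos (flowSpeed_pos hu hp₁) hgap₁
  have hah' : (a : EReal) < h := EReal.coe_lt_coe hah
  set K : Set (EuclideanSpace ℝ (Fin n) × ℝ) :=
    {p | 0 ≤ p.2 ∧ p.2 ≤ p₁.2 ∧ u p.1 p.2 ≤ a}
  have hKb : K ⊆ below u h := fun p hp => ⟨hp.1, hp.2.2.trans_lt hah'⟩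
  have hKc : IsCompact K := isCompact_sublevel hu0 hu hah hK p₁.2
  have hSc := (continuousOn_flowSpeed hu).mono hKb
  have hgc := (continuousOn_heightGap (a := a) (b := b) hu).mono hKb
  -- Restricting to points with S ≤ q · (a - bt - u) keeps the denominator positive, because S > 0,
  -- so the ratio is continuous on a compact set.
  set K' : Set (EuclideanSpace ℝ (Fin n) × ℝ) :=
    K ∩ (fun p => flowSpeed α h u p - q * heightGap a b u p) ⁻¹' Set.Iic 0
  have hK'c : IsCompact K' := hKc.of_isClosed_subset
    ((hSc.sub (continuousOn_const.mul hgc)).preimage_isClosed_of_isClosed hKc.isClosed isClosed_Iic)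
    Set.inter_subset_left
  have hgap : ∀ p ∈ K', 0 < heightGap a b u p := by
    intro p hp
    have h1 : flowSpeed α h u p - q * heightGap a b u p ≤ 0 := hp.2
    have h2 := flowSpeed_pos hu (hKb hp.1)
    exact pos_of_mul_pos_right (by linarith : 0 < q * heightGap a b u p) hqpos.le
  have hp₁K : p₁ ∈ K' := by
    refine ⟨⟨hp₁.1, le_rfl, le_of_heightGap_pos hu0 hb hp₁ hgap₁⟩, ?_⟩
    simp [hq, hgap₁.ne']
  obtain ⟨p, hp, hmin⟩ := hK'c.exists_isMinOn ⟨p₁, hp₁K⟩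
    ((hSc.mono Set.inter_subset_left).div (hgc.mono Set.inter_subset_left)
      fun p hp => (hgap p hp).ne')
  have hpb := hKb hp.1
  set m : ℝ := flowSpeed α h u p / heightGap a b u p with hm
  have hmpos : 0 < m := div_pos (flowSpeed_pos hu hpb) (hgap p hp)
  have hmq : m ≤ q := hmin hp₁K
  refine ⟨p, hpb, ?_, hgap p hp, hmq⟩
  by_contra hp0
  have hpt : 0 < p.2 := lt_of_le_of_ne hpb.1 (Ne.symm hp0)
  have hnhds := below_mem_nhds hu hpb hpt
  set f : EuclideanSpace ℝ (Fin n) × ℝ → ℝ :=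
    fun r => flowSpeed α h u r - m * heightGap a b u r with hf
  have hfp : f p = 0 := by
    simp only [hf, hm]; rw [div_mul_cancel₀ _ (hgap p hp).ne', sub_self]
  have hfnonneg : ∀ᶠ r in nhds p, r.2 ≤ p.2 → f p ≤ f r := by
    filter_upwards [hnhds, ((continuousOn_heightGap (a := a) (b := b) hu).continuousAt
      hnhds).eventually (lt_mem_nhds (hgap p hp))] with r hrb hr hrt
    rw [hfp]
    have hrK : r ∈ K := ⟨hrb.1, hrt.trans hp.1.2.1, le_of_heightGap_pos hu0 hb hrb hr⟩
    -- Points outside K' have S > q · gap ≥ m · gap, so they satisfy f ≥ 0 as well.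
    by_cases hrq : flowSpeed α h u r - q * heightGap a b u r ≤ 0
    · have h1 : m ≤ flowSpeed α h u r / heightGap a b u r := hmin (show r ∈ K' from ⟨hrK, hrq⟩)
      exact sub_nonneg.2 ((le_div_iff₀ hr).1 h1)
    · have h1 := mul_le_mul_of_nonneg_right hmq hr.le
      simp only [hf]; linarith
  have hline : ∀ w : EuclideanSpace ℝ (Fin n) × ℝ,
      Filter.Tendsto (fun r : ℝ => p + r • w) (nhds 0) (nhds p) := by
    intro w
    have : Continuous fun r : ℝ => p + r • w := by fun_prop
    simpa using this.tendsto 0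
  have huniq := uniqueDiffOn_below hu
  have hfs : ContDiffOn ℝ ∞ f (below u h) :=
    ((contDiffOn_divNormalizedGrad huniq (contDiffOn_spaceTime hu)).rpow_const_of_ne fun _ hq =>
      (divNormalizedGrad_pos hu hq).ne').sub (contDiffOn_const.mul
        ((contDiffOn_const.sub (contDiffOn_const.mul contDiff_snd.contDiffOn)).sub
          (contDiffOn_spaceTime hu)))
  have hspace : ∀ w : EuclideanSpace ℝ (Fin n) × ℝ, w.2 = 0 →
      dirDeriv (below u h) w f p = 0 ∧
        0 ≤ dirDeriv (below u h) w (dirDeriv (below u h) w f) p := by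
    intro w hw
    refine dirDeriv_of_line_min huniq hfs ((hline w).eventually hnhds) ?_
    filter_upwards [(hline w).eventually hfnonneg] with r hr
    exact hr (by simp [hw])
  refine false_of_touching (e := spaceDir) (f := f) (a := a) huniq
    (below_subset_closure_interior hu)
    (contDiffOn_spaceTime hu) hα hb hmpos (τ := ((0, 1) : EuclideanSpace ℝ (Fin n) × ℝ))
    (ContinuousLinearMap.snd ℝ (EuclideanSpace ℝ (Fin n)) ℝ) (by simp) (by simp [spaceDir])
    (fun q hq => divNormalizedGrad_pos hu hq) (fun q hq => dirDeriv_time_spaceTime hu hq) hpb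
    (fun q => rfl) (fun i => (hspace _ (by simp [spaceDir])).1)
    (fun c => (hspace _ (by simp [spaceDir, Prod.snd_sum])).2) ?_ ?_
  · refine dirDeriv_nonpos_of_left_min hfs hpb
      (((hline _).eventually hnhds).filter_mono nhdsWithin_le_nhds) ?_
    filter_upwards [((hline (0, 1)).eventually hfnonneg).filter_mono nhdsWithin_le_nhds,
      self_mem_nhdsWithin] with r hr hr0
    exact hr (by simpa using le_of_lt hr0)
  · refine hcase.imp_right fun hc => ?_
    rcases le_or_gt α 1 with h1 | h1
    · exact (mul_nonpos_of_nonpos_of_nonneg (sub_nonpos.2 h1) (flowSpeed_pos hu hpb).le).trans hb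
    · refine le_trans (mul_le_mul_of_nonneg_left ?_ (sub_nonneg.2 h1.le)) hc
      -- At the minimum S = m · gap ≤ q a, which transfers the hypothesis at `p₁` to p.
      have h2 : flowSpeed α h u p = m * heightGap a b u p := sub_eq_zero.1 hfp
      change flowSpeed α h u p ≤ _
      rw [h2]
      exact mul_le_mul hmq (heightGap_le hu0 hb hpb) (hgap p hp).le hqpos.le

theorem mem_localizedGraph_iff (hu0 : ∀ x, ∀ t, 0 ≤ t → 0 ≤ u x t) (hb : 0 ≤ b) {t : ℝ}
    (ht : 0 ≤ t) {X : EuclideanSpace ℝ (Fin n) × ℝ} :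
    X ∈ localizedGraph a b u t ↔
      (X.1, t) ∈ below u (a + 1) ∧ spaceTime u (X.1, t) = X.2 ∧ 0 < heightGap a b u (X.1, t) := by
  constructor
  · rintro ⟨hX, hgap⟩
    have hX' : u X.1 t = X.2 := hX
    have h1 : spaceTime u (X.1, t) = X.2 := by simp [spaceTime, slice, hX']
    have h2 : 0 < a - b * t - X.2 := (lt_max_iff.1 hgap).resolve_right (lt_irrefl _)
    refine ⟨⟨ht, ?_⟩, h1, by simpa [heightGap, h1] using h2⟩
    have := mul_nonneg hb ht
    change u X.1 t < _
    rw [hX']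
    exact_mod_cast (by linarith : X.2 < a + 1)
  · rintro ⟨hb', h1, h2⟩
    refine ⟨?_, ?_⟩
    · change u X.1 t = X.2
      rw [← h1, coe_spaceTime hu0 hb']
    · rw [cutoff, ← h1]; exact lt_max_of_lt_left h2

theorem ratio_eq (hu : IsHAlphaFlowBelow α (a + 1) u) {t : ℝ}
    {X : EuclideanSpace ℝ (Fin n) × ℝ} (hX : (X.1, t) ∈ below u (a + 1))
    (hX2 : spaceTime u (X.1, t) = X.2) (hgap : 0 < heightGap a b u (X.1, t)) :
    (cutoff a b t X)⁻¹ * speed α u t X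
      = flowSpeed α (a + 1) u (X.1, t) / heightGap a b u (X.1, t) := by
  have h1 : cutoff a b t X = heightGap a b u (X.1, t) := by
    rw [cutoff, ← hX2]; exact max_eq_left hgap.le
  rw [h1, speed, graphMeanCurvature_slice hu hX, div_eq_inv_mul, flowSpeed]

theorem initialInf_le_ratio (hα : 0 < α) (hb : 0 ≤ b) (hu0 : ∀ x, ∀ t, 0 ≤ t → 0 ≤ u x t)
    (hK : IsCompact {x | u x 0 ≤ (a : EReal)}) (hu : IsHAlphaFlowBelow α (a + 1) u) {t : ℝ}
    (ht : 0 ≤ t) {X : EuclideanSpace ℝ (Fin n) × ℝ} (hX : X ∈ localizedGraph a b u t)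
    (hcase : α ≤ 1 ∨ (α - 1) * ((cutoff a b t X)⁻¹ * speed α u t X * a) ≤ b) :
    initialInf α a b u ≤ (((cutoff a b t X)⁻¹ * speed α u t X : ℝ) : EReal) := by
  obtain ⟨hXb, hX2, hgap⟩ := (mem_localizedGraph_iff hu0 hb ht).1 hX
  rw [ratio_eq hu hXb hX2 hgap] at hcase ⊢
  obtain ⟨⟨x, r⟩, hpb, hr, hpgap, hle⟩ :=
    exists_initial_ratio_le hα hb hu0 hK (lt_add_one a) hu hXb hgap hcase
  obtain rfl : r = 0 := hr
  have hmem : (x, spaceTime u (x, 0)) ∈ localizedGraph a b u 0 :=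
    (mem_localizedGraph_iff hu0 hb le_rfl).2 ⟨hpb, rfl, hpgap⟩
  refine (iInf₂_le _ hmem).trans ?_
  rw [ratio_eq (X := (x, spaceTime u (x, 0))) hu hpb rfl hpgap]
  exact EReal.coe_le_coe_iff.2 hle

theorem pos_of_mem_localizedGraph (hb : 0 ≤ b) (hu0 : ∀ x, ∀ t, 0 ≤ t → 0 ≤ u x t) {t : ℝ}
    (ht : 0 ≤ t) {X : EuclideanSpace ℝ (Fin n) × ℝ} (hX : X ∈ localizedGraph a b u t) : 0 < a := by
  obtain ⟨hXb, _, hgap⟩ := (mem_localizedGraph_iff hu0 hb ht).1 hX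
  exact hgap.trans_le (heightGap_le hu0 hb hXb)

/-- Either the ratio is small enough for the minimum principle to apply, or it is already at least b
/ (a (α - 1)). -/
theorem min_initialInf_le_ratio (hα : 1 < α) (hb : 0 ≤ b) (hu0 : ∀ x, ∀ t, 0 ≤ t → 0 ≤ u x t)
    (hK : IsCompact {x | u x 0 ≤ (a : EReal)}) (hu : IsHAlphaFlowBelow α (a + 1) u) {t : ℝ}
    (ht : 0 ≤ t) {X : EuclideanSpace ℝ (Fin n) × ℝ} (hX : X ∈ localizedGraph a b u t) :
    min (initialInf α a b u) ((b / (a * (α - 1)) : ℝ) : EReal) ≤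
      (((cutoff a b t X)⁻¹ * speed α u t X : ℝ) : EReal) := by
  have ha := pos_of_mem_localizedGraph hb hu0 ht hX
  rcases le_total ((α - 1) * ((cutoff a b t X)⁻¹ * speed α u t X * a)) b with hc | hc
  · exact (min_le_left _ _).trans
      (initialInf_le_ratio (zero_lt_one.trans hα) hb hu0 hK hu ht hX (Or.inr hc))
  · refine (min_le_right _ _).trans (EReal.coe_le_coe_iff.2 ?_)
    rw [div_le_iff₀ (mul_pos ha (sub_pos.2 hα))]
    linarith

/-- The bound is min H^α / a, the minimum being over the compact initial sublevel set, since 0 < ψ ≤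
a on the localized graph. -/
theorem exists_pos_le_initialInf (hb : 0 ≤ b) (hu0 : ∀ x, ∀ t, 0 ≤ t → 0 ≤ u x t)
    (hK : IsCompact {x | u x 0 ≤ (a : EReal)}) (hu : IsHAlphaFlowBelow α (a + 1) u) :
    ∃ κ : ℝ, 0 < κ ∧ (κ : EReal) ≤ initialInf α a b u := by
  rcases (localizedGraph a b u 0).eq_empty_or_nonempty with hE | ⟨X₀, hX₀⟩
  · exact ⟨1, one_pos, by simp [initialInf, hE]⟩
  have ha := pos_of_mem_localizedGraph hb hu0 le_rfl hX₀
  have hKc := isCompact_sublevel hu0 hu (lt_add_one a) hK 0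
  have hmemK : ∀ X ∈ localizedGraph a b u 0, (X.1, (0 : ℝ)) ∈
      {p : EuclideanSpace ℝ (Fin n) × ℝ | 0 ≤ p.2 ∧ p.2 ≤ 0 ∧ u p.1 p.2 ≤ a} := by
    intro X hX
    obtain ⟨hXb, _, hgap⟩ := (mem_localizedGraph_iff hu0 hb le_rfl).1 hX
    exact ⟨le_rfl, le_rfl, le_of_heightGap_pos hu0 hb hXb hgap⟩
  have hsub : {p : EuclideanSpace ℝ (Fin n) × ℝ | 0 ≤ p.2 ∧ p.2 ≤ 0 ∧ u p.1 p.2 ≤ a}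
      ⊆ below u (a + 1) :=
    fun p hp => ⟨hp.1, hp.2.2.trans_lt (EReal.coe_lt_coe (lt_add_one a))⟩
  obtain ⟨p, hp, hmin⟩ := hKc.exists_isMinOn ⟨_, hmemK X₀ hX₀⟩
    ((continuousOn_flowSpeed hu).mono hsub)
  have hSp := flowSpeed_pos hu (hsub hp)
  refine ⟨flowSpeed α (a + 1) u p / a, div_pos hSp ha, le_iInf₂ fun X hX => ?_⟩
  obtain ⟨hXb, hX2, hgap⟩ := (mem_localizedGraph_iff hu0 hb le_rfl).1 hX
  rw [ratio_eq hu hXb hX2 hgap, EReal.coe_le_coe_iff]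
  exact div_le_div₀ (flowSpeed_pos hu hXb).le (hmin (hmemK X hX)) hgap (heightGap_le hu0 hb hXb)

theorem mul_le_speed_of_le_ratio {κ δ t : ℝ} (hκ : 0 < κ) (hδ : 0 < δ)
    {X : EuclideanSpace ℝ (Fin n) × ℝ} (hX : δ ≤ cutoff a b t X)
    (h : (κ : EReal) ≤ (((cutoff a b t X)⁻¹ * speed α u t X : ℝ) : EReal)) :
    δ * κ ≤ speed α u t X := by
  have hc : 0 < cutoff a b t X := hδ.trans_le hX
  have h1 := EReal.coe_le_coe_iff.1 h
  rw [← div_eq_inv_mul, le_div_iff₀ hc] at h1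
  calc δ * κ ≤ cutoff a b t X * κ := mul_le_mul_of_nonneg_right hX hκ.le
    _ ≤ speed α u t X := by linarith

end MinimumPrinciple

/-! ### The lower bounds for the speed. -/

theorem mainTheorem6 {n : ℕ} (α a b : ℝ) (hα : 0 < α) (hb : 0 ≤ b)
    (u : EuclideanSpace ℝ (Fin n) → ℝ → EReal)
    (hu_nonneg : ∀ x, ∀ t, 0 ≤ t → 0 ≤ u x t)
    (hu_compact : ∀ t, 0 ≤ t → IsCompact {x | u x t ≤ (a : EReal)})
    (hu_flow : IsHAlphaFlowBelow α (a + 1) u) :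
    (α ≤ 1 → ∀ t, 0 ≤ t → ∀ X ∈ localizedGraph a b u t,
      initialInf α a b u ≤ (((cutoff a b t X)⁻¹ * speed α u t X : ℝ) : EReal)) ∧
    (1 < α → ∀ t, 0 ≤ t → ∀ X ∈ localizedGraph a b u t,
      min (initialInf α a b u) ((b / (a * (α - 1)) : ℝ) : EReal) ≤
        (((cutoff a b t X)⁻¹ * speed α u t X : ℝ) : EReal)) ∧
    0 < initialInf α a b u ∧
    (α ≤ 1 ∨ 0 < b → ∀ δ : ℝ, 0 < δ → ∃ c : ℝ, 0 < c ∧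
      ∀ t, 0 ≤ t → ∀ X ∈ graphAt u t, δ ≤ cutoff a b t X → c ≤ speed α u t X) := by
  have hK := hu_compact 0 le_rfl
  have hle : α ≤ 1 → ∀ t, 0 ≤ t → ∀ X ∈ localizedGraph a b u t,
      initialInf α a b u ≤ (((cutoff a b t X)⁻¹ * speed α u t X : ℝ) : EReal) :=
    fun h t ht X hX => initialInf_le_ratio hα hb hu_nonneg hK hu_flow ht hX (Or.inl h)
  have hgt : 1 < α → ∀ t, 0 ≤ t → ∀ X ∈ localizedGraph a b u t,
      min (initialInf α a b u) ((b / (a * (α - 1)) : ℝ) : EReal) ≤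
        (((cutoff a b t X)⁻¹ * speed α u t X : ℝ) : EReal) :=
    fun h t ht X hX => min_initialInf_le_ratio h hb hu_nonneg hK hu_flow ht hX
  obtain ⟨κ, hκ, hκI⟩ := exists_pos_le_initialInf hb hu_nonneg hK hu_flow
  refine ⟨hle, hgt, (EReal.coe_pos.2 hκ).trans_le hκI, fun hcase δ hδ => ?_⟩
  rcases le_or_gt α 1 with h | h
  · exact ⟨δ * κ, mul_pos hδ hκ, fun t ht X hX hXδ => mul_le_speed_of_le_ratio hκ hδ hXδ
      (hκI.trans (hle h t ht X ⟨hX, hδ.trans_le hXδ⟩))⟩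
  · have hb' : 0 < b := hcase.resolve_left (not_le.2 h)
    -- For a ≤ 0 there are no points with ψ > 0, so any constant serves; for a > 0 the quotient b /
    -- (a (α - 1)) is positive.
    rcases le_or_gt a 0 with ha | ha
    · exact ⟨1, one_pos, fun t ht X hX hXδ => absurd
        (pos_of_mem_localizedGraph hb hu_nonneg ht ⟨hX, hδ.trans_le hXδ⟩) (not_lt.2 ha)⟩
    · have hκ' : 0 < min κ (b / (a * (α - 1))) :=
        lt_min hκ (div_pos hb' (mul_pos ha (sub_pos.2 h)))
      refine ⟨δ * min κ (b / (a * (α - 1))), mul_pos hδ hκ', fun t ht X hX hXδ =>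
        mul_le_speed_of_le_ratio hκ' hδ hXδ
          (le_trans (le_min ?_ ?_) (hgt h t ht X ⟨hX, hδ.trans_le hXδ⟩))⟩
      · exact (EReal.coe_le_coe_iff.2 (min_le_left _ _)).trans hκI
      · exact EReal.coe_le_coe_iff.2 (min_le_right _ _)
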